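/- Let $C$ be a set of four candidates. A preference is a strict total order on $C$, and a preference profile on $C$ is a finite set $R$ of pairwise distinct preferences; its size is $|R|$. For a norm $\|\cdot\|$ on $\mathbb{R}^2$, the profile $R$ is called Euclidean with respect to $\|\cdot\|$ if there are points $f(c)\in\mathbb{R}^2$ for $c\in C$ and points $g(\succ)\in\mathbb{R}^2$ for $\succ\,\in R$ such that, for every $\succ\,\in R$ and all $a,b\in C$, $$a\succ b\ \Longrightarrow\ \|g(\succ)-f(a)\|<\|g(\succ)-f(b)\|.$$ Theorem. The maximum size of a preference profile on four candidates that is Euclidean in the plane with respect to the $\ell_1$ norm is exactly $19$: some such profile consists of $19$ pairwise distinct preferences, and none has more. The same holds with respect to the $\ell_\infty$ norm. -/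

import Mathlib

open scoped ENNReal

/-- A preference over the set `C` of candidates: a ranking of all candidates without ties, i.e. a
strict total order, where `r.Prefers a b` means that `a` is strictly preferred to `b`. Two rankings
are equal exactly when they are the same relation. -/
structure Ranking (C : Type*) where
  Prefers : C → C → Prop
  irrefl : ∀ a, ¬ Prefers a a
  trans : ∀ a b c, Prefers a b → Prefers b c → Prefers a c
  total : ∀ a b, a ≠ b → Prefers a b ∨ Prefers b a

/-- A preference profile on the candidates `C` is a finite set of pairwise distinct preferences,
one for each voter. Its size is its cardinality. -/
abbrev PreferenceProfile (C : Type*) := Finset (Ranking C)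

/-- A profile is Euclidean in the normed space `E` if its voters and the candidates can be placed in
`E` such that every voter who prefers `a` to `b` is strictly closer to `a` than to `b`. The voters
of a profile are indexed by their (pairwise distinct) preferences. -/
def PreferenceProfile.IsEuclidean {C : Type*} (R : PreferenceProfile C)
    (E : Type*) [NormedAddCommGroup E] : Prop :=
  ∃ (voterPos : R → E) (candPos : C → E), ∀ (v : R) (a b : C),
    v.1.Prefers a b → ‖voterPos v - candPos a‖ < ‖voterPos v - candPos b‖

/-- The set of all sizes of profiles on `C` that are Euclidean in the plane `ℝ²` with the norm
`ℓ_p`. -/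
def euclideanProfileSizes (p : ℝ≥0∞) [Fact (1 ≤ p)] (C : Type*) : Set ℕ :=
  {n | ∃ R : PreferenceProfile C, R.IsEuclidean (PiLp p (fun _ : Fin 2 => ℝ)) ∧ R.card = n}

/-!
Under `(x, y) ↦ (x + y, x - y)` the `ℓ₁` norm becomes the `ℓ_∞` norm, so both statements are about
profiles that are Euclidean in `ℝ × ℝ`, whose norm is the maximum norm.

**At most 19.** Place four candidates in `ℝ × ℝ` and let `L`, `R`, `T`, `B` be a leftmost, a
rightmost, a topmost and a bottommost one. A candidate that is strictly furthest from a voter must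
be one of these four (`BoundingBox.exists_extreme_le`), so if they do not exhaust the candidates,
some candidate is never ranked last and six of the 24 rankings are missing. Otherwise let `W` and
`H` be the width and the height of the bounding box; by symmetry `H ≤ W`. If `L` and `R` are closer
to a voter `v` than `T` and `B`, then the distances to `T` and `B` are vertical, they add up to `H`,
and they exceed the horizontal distances to `L` and `R`, which add up to at least `W`: this is
impossible and four rankings are missing. Finally, the rankings `LTRB`, `RBLT`, `LBRT`, `RTLB` do
not all occur: each of them forces a gap inequality between coordinates
(`BoundingBox.gap_LTRB` and its mirror images), and these four add up to `2 * W < 2 * H`.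
So at least five rankings are missing.

**At least 19.** Four candidates and 19 voters at integer points do it; that the 19 rankings are
well defined and pairwise distinct is a finite computation with integers.
-/

/-! ### The plane with the maximum norm -/

theorem max_abs_add_abs_sub (a b : ℝ) : max |a + b| |a - b| = |a| + |b| := by
  grind

namespace PreferenceProfile

/-- Being Euclidean is preserved by maps that preserve distances. -/
theorem IsEuclidean.map {C E F : Type*} [NormedAddCommGroup E] [NormedAddCommGroup F]
    {R : PreferenceProfile C} (h : R.IsEuclidean E) (f : E → F)
    (hf : ∀ x y, ‖f x - f y‖ = ‖x - y‖) : R.IsEuclidean F := by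
  obtain ⟨g, p, hgp⟩ := h
  exact ⟨f ∘ g, f ∘ p, fun v a b hab => by simpa only [Function.comp_apply, hf] using hgp v a b hab⟩

theorem isEuclidean_piLp_top_iff {C : Type*} {R : PreferenceProfile C} :
    R.IsEuclidean (PiLp ∞ fun _ : Fin 2 => ℝ) ↔ R.IsEuclidean (ℝ × ℝ) := by
  have key (x : PiLp ∞ fun _ : Fin 2 => ℝ) : ‖x‖ = max |x 0| |x 1| := by
    rw [← PiLp.norm_ofLp, Pi.norm_def, Finset.univ_fin2]
    simp
  refine ⟨fun h => h.map (fun x => (x 0, x 1)) fun x y => ?_,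
    fun h => h.map (fun x => WithLp.toLp ∞ ![x.1, x.2]) fun x y => ?_⟩ <;>
  simp [key, Prod.norm_def]

theorem isEuclidean_piLp_one_iff {C : Type*} {R : PreferenceProfile C} :
    R.IsEuclidean (PiLp 1 fun _ : Fin 2 => ℝ) ↔ R.IsEuclidean (ℝ × ℝ) := by
  refine ⟨fun h => h.map (fun x => (x 0 + x 1, x 0 - x 1)) fun x y => ?_,
    fun h => h.map (fun x => WithLp.toLp 1 ![(x.1 + x.2) / 2, (x.1 - x.2) / 2]) fun x y => ?_⟩
  · rw [PiLp.norm_eq_of_L1, Fin.sum_univ_two, Real.norm_eq_abs, Real.norm_eq_abs,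
      ← max_abs_add_abs_sub]
    simp only [Prod.norm_def, Prod.fst_sub, Prod.snd_sub, PiLp.sub_apply, Real.norm_eq_abs]
    ring_nf
  · rw [PiLp.norm_eq_of_L1, Fin.sum_univ_two, Real.norm_eq_abs, Real.norm_eq_abs,
      ← max_abs_add_abs_sub]
    simp only [Prod.norm_def, Prod.fst_sub, Prod.snd_sub, PiLp.sub_apply, Real.norm_eq_abs,
      Matrix.cons_val_zero, Matrix.cons_val_one]
    ring_nf

end PreferenceProfile

theorem norm_sub_lt_iff {v a : ℝ × ℝ} {r : ℝ} : ‖v - a‖ < r ↔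
    (v.1 - a.1 < r ∧ a.1 - v.1 < r) ∧ v.2 - a.2 < r ∧ a.2 - v.2 < r := by
  simp only [Prod.norm_def, Prod.fst_sub, Prod.snd_sub, Real.norm_eq_abs, max_lt_iff, abs_sub_lt_iff]

theorem norm_sub_eq_cases (v a : ℝ × ℝ) : ‖v - a‖ = v.1 - a.1 ∨ ‖v - a‖ = a.1 - v.1 ∨
    ‖v - a‖ = v.2 - a.2 ∨ ‖v - a‖ = a.2 - v.2 := by
  simp only [Prod.norm_def, Prod.fst_sub, Prod.snd_sub, Real.norm_eq_abs]
  grind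

/-! ### The bounding box of a set of candidates -/

/-- The candidates `L`, `R`, `T`, `B` are a leftmost, a rightmost, a topmost and a bottommost one
among the candidates placed by `p`. They need not be distinct or uniquely determined. -/
structure BoundingBox {C : Type*} (p : C → ℝ × ℝ) (L R T B : C) : Prop where
  left : ∀ c, (p L).1 ≤ (p c).1
  right : ∀ c, (p c).1 ≤ (p R).1
  top : ∀ c, (p c).2 ≤ (p T).2
  bottom : ∀ c, (p B).2 ≤ (p c).2

/-- Reflection of the plane in the vertical axis. -/
def reflX (x : ℝ × ℝ) : ℝ × ℝ := (-x.1, x.2)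

/-- Reflection of the plane in the horizontal axis. -/
def reflY (x : ℝ × ℝ) : ℝ × ℝ := (x.1, -x.2)

theorem norm_reflX_sub (x y : ℝ × ℝ) : ‖reflX x - reflX y‖ = ‖x - y‖ := by
  simp [reflX, Prod.norm_def, neg_add_eq_sub, abs_sub_comm]

theorem norm_reflY_sub (x y : ℝ × ℝ) : ‖reflY x - reflY y‖ = ‖x - y‖ := by
  simp [reflY, Prod.norm_def, neg_add_eq_sub, abs_sub_comm]

theorem norm_swap_sub (x y : ℝ × ℝ) : ‖x.swap - y.swap‖ = ‖x - y‖ := by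
  simp [Prod.norm_def, max_comm]

namespace BoundingBox

variable {C : Type*} {p : C → ℝ × ℝ} {L R T B : C}

theorem exists_of_finite [Finite C] [Nonempty C] (p : C → ℝ × ℝ) :
    ∃ L R T B, BoundingBox p L R T B := by
  obtain ⟨L, hL⟩ := Finite.exists_min fun c => (p c).1
  obtain ⟨R, hR⟩ := Finite.exists_max fun c => (p c).1
  obtain ⟨T, hT⟩ := Finite.exists_max fun c => (p c).2
  obtain ⟨B, hB⟩ := Finite.exists_min fun c => (p c).2
  exact ⟨L, R, T, B, hL, hR, hT, hB⟩

theorem reflX (h : BoundingBox p L R T B) : BoundingBox (reflX ∘ p) R L T B where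
  left c := neg_le_neg (h.right c)
  right c := neg_le_neg (h.left c)
  top := h.top
  bottom := h.bottom

theorem reflY (h : BoundingBox p L R T B) : BoundingBox (reflY ∘ p) L R B T where
  left := h.left
  right := h.right
  top c := neg_le_neg (h.bottom c)
  bottom c := neg_le_neg (h.top c)

theorem swap (h : BoundingBox p L R T B) : BoundingBox (Prod.swap ∘ p) B T R L :=
  ⟨h.bottom, h.top, h.right, h.left⟩

/-- One of the four extreme candidates is at least as far from the voter as any given candidate. -/
theorem exists_extreme_le (h : BoundingBox p L R T B) (v : ℝ × ℝ) (c : C) :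
    ‖v - p c‖ ≤ ‖v - p L‖ ∨ ‖v - p c‖ ≤ ‖v - p R‖ ∨ ‖v - p c‖ ≤ ‖v - p T‖ ∨
      ‖v - p c‖ ≤ ‖v - p B‖ := by
  by_contra! hc
  simp only [norm_sub_lt_iff] at hc
  have := h.left c
  have := h.right c
  have := h.top c
  have := h.bottom c
  rcases norm_sub_eq_cases v (p c) with h' | h' | h' | h' <;> linarith

/-- A candidate at the bottom can be further away than `L` and `R` only in the vertical direction,
since its horizontal distance is bounded by those of `L` and `R`. -/
theorem norm_sub_bottom (h : BoundingBox p L R T B) {v : ℝ × ℝ} (hL : ‖v - p L‖ < ‖v - p B‖)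
    (hR : ‖v - p R‖ < ‖v - p B‖) : ‖v - p B‖ = v.2 - (p B).2 := by
  rw [norm_sub_lt_iff] at hL hR
  have := h.left B
  have := h.right B
  have := h.bottom L
  rcases norm_sub_eq_cases v (p B) with h' | h' | h' | h' <;> linarith

/-- If the box is at least as wide as it is high, then `L` and `R` cannot both be closer to a voter
than both `T` and `B`. -/
theorem not_LR_before_TB (h : BoundingBox p L R T B)
    (hw : (p T).2 - (p B).2 ≤ (p R).1 - (p L).1) {v : ℝ × ℝ}
    (hLT : ‖v - p L‖ < ‖v - p T‖) (hRT : ‖v - p R‖ < ‖v - p T‖)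
    (hLB : ‖v - p L‖ < ‖v - p B‖) (hRB : ‖v - p R‖ < ‖v - p B‖) : False := by
  have hB := h.norm_sub_bottom hLB hRB
  have hT := h.reflY.norm_sub_bottom (v := _root_.reflY v)
    (by simpa only [Function.comp_apply, norm_reflY_sub])
    (by simpa only [Function.comp_apply, norm_reflY_sub])
  simp only [Function.comp_apply, norm_reflY_sub] at hT
  simp only [_root_.reflY] at hT
  rw [norm_sub_lt_iff] at hLT hRB
  linarith

/-- In a box at least as wide as it is high, a voter who ranks `L`, `T`, `R`, `B` in this order
sees `T` at a horizontal distance, and this forces the gap from `T` to the right side to be smaller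
than the gap from `L` to the bottom side. -/
theorem gap_LTRB (h : BoundingBox p L R T B)
    (hw : (p T).2 - (p B).2 ≤ (p R).1 - (p L).1) {v : ℝ × ℝ} (hLT : ‖v - p L‖ < ‖v - p T‖)
    (hTR : ‖v - p T‖ < ‖v - p R‖) (hRB : ‖v - p R‖ < ‖v - p B‖) :
    (p R).1 - (p T).1 < (p L).2 - (p B).2 := by
  have hB := h.norm_sub_bottom (hLT.trans (hTR.trans hRB)) hRB
  rw [norm_sub_lt_iff] at hLT hRB
  have := h.left T
  have := h.top L
  rcases norm_sub_eq_cases v (p T) with h' | h' | h' | h' <;> linarith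

theorem gap_RTLB (h : BoundingBox p L R T B)
    (hw : (p T).2 - (p B).2 ≤ (p R).1 - (p L).1) {v : ℝ × ℝ} (hRT : ‖v - p R‖ < ‖v - p T‖)
    (hTL : ‖v - p T‖ < ‖v - p L‖) (hLB : ‖v - p L‖ < ‖v - p B‖) :
    (p T).1 - (p L).1 < (p R).2 - (p B).2 := by
  have := h.reflX.gap_LTRB (v := _root_.reflX v)
    (by simp only [Function.comp_apply, _root_.reflX]; linarith)
    (by simpa only [Function.comp_apply, norm_reflX_sub])
    (by simpa only [Function.comp_apply, norm_reflX_sub])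
    (by simpa only [Function.comp_apply, norm_reflX_sub])
  simp only [Function.comp_apply, _root_.reflX] at this
  linarith

theorem gap_LBRT (h : BoundingBox p L R T B)
    (hw : (p T).2 - (p B).2 ≤ (p R).1 - (p L).1) {v : ℝ × ℝ} (hLB : ‖v - p L‖ < ‖v - p B‖)
    (hBR : ‖v - p B‖ < ‖v - p R‖) (hRT : ‖v - p R‖ < ‖v - p T‖) :
    (p R).1 - (p B).1 < (p T).2 - (p L).2 := by
  have := h.reflY.gap_LTRB (v := _root_.reflY v)
    (by simp only [Function.comp_apply, _root_.reflY]; linarith)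
    (by simpa only [Function.comp_apply, norm_reflY_sub])
    (by simpa only [Function.comp_apply, norm_reflY_sub])
    (by simpa only [Function.comp_apply, norm_reflY_sub])
  simp only [Function.comp_apply, _root_.reflY] at this
  linarith

theorem gap_RBLT (h : BoundingBox p L R T B)
    (hw : (p T).2 - (p B).2 ≤ (p R).1 - (p L).1) {v : ℝ × ℝ} (hRB : ‖v - p R‖ < ‖v - p B‖)
    (hBL : ‖v - p B‖ < ‖v - p L‖) (hLT : ‖v - p L‖ < ‖v - p T‖) :
    (p B).1 - (p L).1 < (p T).2 - (p R).2 := by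
  have := h.reflX.gap_LBRT (v := _root_.reflX v)
    (by simp only [Function.comp_apply, _root_.reflX]; linarith)
    (by simpa only [Function.comp_apply, norm_reflX_sub])
    (by simpa only [Function.comp_apply, norm_reflX_sub])
    (by simpa only [Function.comp_apply, norm_reflX_sub])
  simp only [Function.comp_apply, _root_.reflX] at this
  linarith

end BoundingBox

/-! ### Orderings of the candidates seen by some voter -/

/-- Some point of the plane is strictly closer to `p (f i)` than to `p (f j)` whenever `i < j`:
a voter there ranks the candidates in the order `f 0, f 1, f 2, f 3`. -/
def Realizable {C : Type*} (p : C → ℝ × ℝ) (f : Fin 4 → C) : Prop :=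
  ∃ v : ℝ × ℝ, StrictMono fun i => ‖v - p (f i)‖

theorem Realizable.injective {C : Type*} {p : C → ℝ × ℝ} {f : Fin 4 → C} (h : Realizable p f) :
    Function.Injective f := by
  obtain ⟨v, hv⟩ := h
  exact fun i j hij => hv.injective (by simp only [hij])

theorem realizable_swap_comp_iff {C : Type*} {p : C → ℝ × ℝ} {f : Fin 4 → C} :
    Realizable (Prod.swap ∘ p) f ↔ Realizable p f := by
  constructor
  · rintro ⟨v, hv⟩
    exact ⟨v.swap, by simpa [← norm_swap_sub v.swap] using hv⟩
  · rintro ⟨v, hv⟩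
    exact ⟨v.swap, by simpa only [Function.comp_apply, norm_swap_sub] using hv⟩

/-- At least five orderings of the candidates are not realizable. They are given as permutations
`f ∈ N` of the positions in an enumeration `τ`, so that they can be counted by computation. -/
def MissesFive {C : Type*} (p : C → ℝ × ℝ) : Prop :=
  ∃ (τ : Fin 4 → C) (N : Finset (Fin 4 → Fin 4)), Function.Injective τ ∧ N.card = 5 ∧
    (∀ f ∈ N, Function.Injective f) ∧ ∀ f ∈ N, ¬ Realizable p (τ ∘ f)

theorem MissesFive.of_swap {C : Type*} {p : C → ℝ × ℝ} (h : MissesFive (Prod.swap ∘ p)) :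
    MissesFive p := by
  obtain ⟨τ, N, hτ, hN, hinj, hr⟩ := h
  exact ⟨τ, N, hτ, hN, hinj, fun f hf => by simpa only [realizable_swap_comp_iff] using hr f hf⟩

set_option maxRecDepth 10000 in
/-- The orderings of the four extreme candidates that are missing when the box is at least as wide
as it is high. -/
theorem BoundingBox.missesFive_of_wide {C : Type*} {p : C → ℝ × ℝ} {L R T B : C}
    (h : BoundingBox p L R T B) (hinj : Function.Injective ![L, R, T, B])
    (hw : (p T).2 - (p B).2 ≤ (p R).1 - (p L).1) : MissesFive p := by
  have h1 : ¬ Realizable p (![L, R, T, B] ∘ ![0, 1, 2, 3]) := by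
    rintro ⟨v, hv⟩
    exact h.not_LR_before_TB hw (hv (show 0 < 2 by decide)) (hv (show 1 < 2 by decide))
      (hv (show 0 < 3 by decide)) (hv (show 1 < 3 by decide))
  have h2 : ¬ Realizable p (![L, R, T, B] ∘ ![0, 1, 3, 2]) := by
    rintro ⟨v, hv⟩
    exact h.not_LR_before_TB hw (hv (show 0 < 3 by decide)) (hv (show 1 < 3 by decide))
      (hv (show 0 < 2 by decide)) (hv (show 1 < 2 by decide))
  have h3 : ¬ Realizable p (![L, R, T, B] ∘ ![1, 0, 2, 3]) := by
    rintro ⟨v, hv⟩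
    exact h.not_LR_before_TB hw (hv (show 1 < 2 by decide)) (hv (show 0 < 2 by decide))
      (hv (show 1 < 3 by decide)) (hv (show 0 < 3 by decide))
  have h4 : ¬ Realizable p (![L, R, T, B] ∘ ![1, 0, 3, 2]) := by
    rintro ⟨v, hv⟩
    exact h.not_LR_before_TB hw (hv (show 1 < 3 by decide)) (hv (show 0 < 3 by decide))
      (hv (show 1 < 2 by decide)) (hv (show 0 < 2 by decide))
  -- The orderings `LTRB`, `RTLB`, `LBRT`, `RBLT`: their four gap inequalities add up to twice
  -- the width being less than twice the height.
  have h5 : ∃ g ∈ ({![0, 2, 1, 3], ![1, 2, 0, 3], ![0, 3, 1, 2], ![1, 3, 0, 2]} :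
      Finset (Fin 4 → Fin 4)), ¬ Realizable p (![L, R, T, B] ∘ g) := by
    by_contra! hall
    simp only [Finset.mem_insert, Finset.mem_singleton, forall_eq_or_imp, forall_eq] at hall
    obtain ⟨⟨v₁, h₁⟩, ⟨v₂, h₂⟩, ⟨v₃, h₃⟩, ⟨v₄, h₄⟩⟩ := hall
    have g₁ := h.gap_LTRB hw (h₁ (show 0 < 1 by decide)) (h₁ (show 1 < 2 by decide))
      (h₁ (show 2 < 3 by decide))
    have g₂ := h.gap_RTLB hw (h₂ (show 0 < 1 by decide)) (h₂ (show 1 < 2 by decide))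
      (h₂ (show 2 < 3 by decide))
    have g₃ := h.gap_LBRT hw (h₃ (show 0 < 1 by decide)) (h₃ (show 1 < 2 by decide))
      (h₃ (show 2 < 3 by decide))
    have g₄ := h.gap_RBLT hw (h₄ (show 0 < 1 by decide)) (h₄ (show 1 < 2 by decide))
      (h₄ (show 2 < 3 by decide))
    linarith
  obtain ⟨g, hg, h5⟩ := h5
  refine ⟨_, {g, ![0, 1, 2, 3], ![0, 1, 3, 2], ![1, 0, 2, 3], ![1, 0, 3, 2]}, hinj, ?_, ?_, ?_⟩
  · clear h5; revert g; decide
  · clear h5; revert g; decide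
  · simp only [Finset.mem_insert, Finset.mem_singleton, forall_eq_or_imp, forall_eq]
    exact ⟨h5, h1, h2, h3, h4⟩

set_option maxRecDepth 10000 in
/-- A candidate that differs from the four extreme ones is never ranked last, which excludes six
orderings; the five listed ones are enough. -/
theorem BoundingBox.missesFive_of_ne {C : Type*} [Fintype C] (hC : Fintype.card C = 4)
    {p : C → ℝ × ℝ} {L R T B c : C} (h : BoundingBox p L R T B)
    (hL : L ≠ c) (hR : R ≠ c) (hT : T ≠ c) (hB : B ≠ c) : MissesFive p := by
  classical
  let e : C ≃ Fin 4 := Fintype.equivFinOfCardEq hC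
  let τ : Fin 4 ≃ C := (e.trans (Equiv.swap (e c) 3)).symm
  have hτ : τ 3 = c := by simp [τ]
  refine ⟨τ, {![0, 1, 2, 3], ![0, 2, 1, 3], ![1, 0, 2, 3], ![1, 2, 0, 3], ![2, 0, 1, 3]},
    τ.injective, by decide, by decide, fun f hf => ?_⟩
  have hf' : Function.Injective f ∧ f 3 = 3 := by revert f; decide
  obtain ⟨hinj, hf3⟩ := hf'
  rintro ⟨v, hv⟩
  have hlast (a : C) (ha : a ≠ c) : ‖v - p a‖ < ‖v - p c‖ := by
    obtain ⟨i, rfl⟩ := (τ.surjective.comp (Finite.surjective_of_injective hinj)) a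
    have hi : i ≠ 3 := by rintro rfl; exact ha (by simp [hf3, hτ])
    have := hv (show i < 3 by omega)
    simpa only [Function.comp_apply, hf3, hτ] using this
  have := h.exists_extreme_le v c
  have := hlast L hL
  have := hlast R hR
  have := hlast T hT
  have := hlast B hB
  grind

theorem missesFive {C : Type*} [Fintype C] (hC : Fintype.card C = 4) (p : C → ℝ × ℝ) :
    MissesFive p := by
  have : Nonempty C := Fintype.card_pos_iff.1 (by omega)
  obtain ⟨L, R, T, B, h⟩ := BoundingBox.exists_of_finite p
  by_cases hs : Function.Surjective ![L, R, T, B]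
  · have hinj : Function.Injective ![L, R, T, B] :=
      ((Fintype.bijective_iff_surjective_and_card _).2 ⟨hs, by simp [hC]⟩).injective
    rcases le_total ((p T).2 - (p B).2) ((p R).1 - (p L).1) with hw | hw
    · exact h.missesFive_of_wide hinj hw
    · refine MissesFive.of_swap (h.swap.missesFive_of_wide ?_ hw)
      have : ![B, T, R, L] = ![L, R, T, B] ∘ Fin.rev := by
        ext i; fin_cases i <;> rfl
      rw [this]
      exact hinj.comp Fin.rev_injective
  · simp only [Function.Surjective, not_forall, not_exists] at hs
    obtain ⟨c, hc⟩ := hs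
    exact h.missesFive_of_ne hC (hc 0) (hc 1) (hc 2) (hc 3)

/-! ### At most 19 rankings -/

theorem Ranking.exists_enumeration {C : Type*} [Fintype C] (hC : Fintype.card C = 4)
    (r : Ranking C) : ∃ f : Fin 4 → C, ∀ i j, i < j → r.Prefers (f i) (f j) := by
  classical
  let _ : IsStrictTotalOrder C r.Prefers :=
    { irrefl := r.irrefl
      trans := r.trans
      trichotomous := fun a b hab hba => by
        by_contra hne
        exact (r.total a b hne).elim hab hba }
  let _ : LinearOrder C := linearOrderOfSTO r.Prefers
  exact ⟨monoEquivOfFin C hC, fun i j hij => (monoEquivOfFin C hC).strictMono hij⟩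

theorem Ranking.eq_of_enumeration {C : Type*} [Fintype C] (hC : Fintype.card C = 4)
    {r s : Ranking C} {f : Fin 4 → C} (hr : ∀ i j, i < j → r.Prefers (f i) (f j))
    (hs : ∀ i j, i < j → s.Prefers (f i) (f j)) : r = s := by
  have hinj : Function.Injective f := fun i j hij => by
    rcases lt_trichotomy i j with h | h | h
    · exact absurd (hij ▸ hr i j h) (r.irrefl _)
    · exact h
    · exact absurd (hij ▸ hr j i h) (r.irrefl _)
  have hsurj := ((Fintype.bijective_iff_injective_and_card f).2 ⟨hinj, by simp [hC]⟩).surjective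
  have key (t : Ranking C) (ht : ∀ i j, i < j → t.Prefers (f i) (f j)) (i j : Fin 4) :
      t.Prefers (f i) (f j) ↔ i < j := by
    refine ⟨fun h => ?_, ht i j⟩
    by_contra! hji
    rcases hji.eq_or_lt with rfl | hji
    · exact t.irrefl _ h
    · exact t.irrefl _ (t.trans _ _ _ h (ht _ _ hji))
  have : r.Prefers = s.Prefers := by
    ext a b
    obtain ⟨i, rfl⟩ := hsurj a
    obtain ⟨j, rfl⟩ := hsurj b
    rw [key r hr, key s hs]
  cases r; cases s; congr

theorem PreferenceProfile.IsEuclidean.card_le {C : Type*} [Fintype C] (hC : Fintype.card C = 4)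
    {R : PreferenceProfile C} (h : R.IsEuclidean (ℝ × ℝ)) : R.card ≤ 19 := by
  classical
  obtain ⟨g, p, hgp⟩ := h
  choose enum henum using fun r : Ranking C => r.exists_enumeration hC
  obtain ⟨τ, N, hτ, hN, hNinj, hNp⟩ := missesFive hC p
  let I : Finset (Fin 4 → C) := Finset.univ.filter Function.Injective
  have hI : I.card = 24 := by
    rw [← Fintype.card_subtype, Fintype.card_congr (Equiv.subtypeInjectiveEquivEmbedding (Fin 4) C),
      Fintype.card_embedding_eq, hC, Fintype.card_fin]
    rfl
  have hreal {r : Ranking C} (hr : r ∈ R) : Realizable p (enum r) :=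
    ⟨g ⟨r, hr⟩, fun i j hij => hgp ⟨r, hr⟩ _ _ (henum r i j hij)⟩
  have hRcard : (R.image enum).card = R.card :=
    Finset.card_image_of_injective _ fun r s hrs =>
      Ranking.eq_of_enumeration hC (henum r) (hrs ▸ henum s)
  have hNcard : (N.image (τ ∘ ·)).card = 5 :=
    (Finset.card_image_of_injective _ hτ.comp_left).trans hN
  have hdisj : Disjoint (R.image enum) (N.image (τ ∘ ·)) := by
    simp only [Finset.disjoint_left, Finset.mem_image]
    rintro _ ⟨r, hr, rfl⟩ ⟨f, hf, hfr⟩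
    exact hNp f hf (hfr ▸ hreal hr)
  have hsub : R.image enum ∪ N.image (τ ∘ ·) ⊆ I := by
    refine Finset.union_subset ?_ ?_ <;> intro f hf <;> obtain ⟨r, hr, rfl⟩ := Finset.mem_image.1 hf
    · simpa [I] using (hreal hr).injective
    · simpa [I] using hτ.comp (hNinj r hr)
  have := Finset.card_le_card hsub
  rw [Finset.card_union_of_disjoint hdisj] at this
  omega

/-! ### A profile of 19 rankings -/

/-- Positions of four candidates. The bounding box has width 28 and height 22, with the candidates
in the order left, right, top, bottom. -/
def exampleCand : Fin 4 → ℤ × ℤ := ![(0, 18), (28, 24), (16, 26), (24, 4)]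

/-- Positions of 19 voters, one in the region of each ranking realized by `exampleCand`. -/
def exampleVoter : Fin 19 → ℤ × ℤ :=
  ![(0, 33), (-3, 0), (0, -3), (0, 0), (23, 28), (19, 16), (28, 15), (9, 24), (9, 18), (15, 20),
    (15, 18), (13, 16), (15, 16), (0, -7), (13, 12), (15, 10), (15, 12), (13, 14), (15, 14)]

/-- The distance from a voter to a candidate in the maximum norm, as an integer. -/
def exampleDist (k : Fin 19) (c : Fin 4) : ℤ :=
  max |(exampleVoter k).1 - (exampleCand c).1| |(exampleVoter k).2 - (exampleCand c).2|

theorem exampleDist_injective : ∀ k, Function.Injective (exampleDist k) := by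
  decide

/-- Any two of the voters disagree about some pair of candidates. -/
theorem exists_exampleDist_disagree :
    ∀ k l, k ≠ l → ∃ a b, exampleDist k a < exampleDist k b ∧ ¬ exampleDist l a < exampleDist l b := by
  decide

/-- The ranking of the candidates by increasing value of an injective function. -/
def Ranking.ofInjective {C : Type*} (d : C → ℤ) (hd : Function.Injective d) : Ranking C where
  Prefers a b := d a < d b
  irrefl _ := lt_irrefl _
  trans _ _ _ := lt_trans
  total _ _ hab := lt_or_gt_of_ne (hd.ne hab)

theorem exists_isEuclidean_card_eq {C : Type*} [Fintype C] (hC : Fintype.card C = 4) :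
    ∃ R : PreferenceProfile C, R.IsEuclidean (ℝ × ℝ) ∧ R.card = 19 := by
  let e : C ≃ Fin 4 := Fintype.equivFinOfCardEq hC
  let rk (k : Fin 19) : Ranking C :=
    Ranking.ofInjective (exampleDist k ∘ e) ((exampleDist_injective k).comp e.injective)
  have hrk : Function.Injective rk := by
    intro k l hkl
    by_contra hne
    obtain ⟨a, b, hk, hl⟩ := exists_exampleDist_disagree k l hne
    have h1 : (rk k).Prefers (e.symm a) (e.symm b) := by simpa [rk, Ranking.ofInjective] using hk
    rw [hkl] at h1
    exact hl (by simpa [rk, Ranking.ofInjective] using h1)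
  let toReal (x : ℤ × ℤ) : ℝ × ℝ := (x.1, x.2)
  have hnorm (k : Fin 19) (c : Fin 4) :
      ‖toReal (exampleVoter k) - toReal (exampleCand c)‖ = exampleDist k c := by
    simp [toReal, exampleDist, Prod.norm_def]
  refine ⟨Finset.univ.map ⟨rk, hrk⟩, ?_, by simp⟩
  have hmem (r : (Finset.univ.map ⟨rk, hrk⟩ : PreferenceProfile C)) : ∃ k, rk k = r.1 := by
    obtain ⟨k, -, hk⟩ := Finset.mem_map.1 r.2
    exact ⟨k, hk⟩
  choose idx hidx using hmem
  refine ⟨fun r => toReal (exampleVoter (idx r)), fun c => toReal (exampleCand (e c)),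
    fun r a b hab => ?_⟩
  rw [hnorm, hnorm, Int.cast_lt]
  rwa [← hidx r] at hab

theorem isGreatest_card_isEuclidean {C : Type*} [Fintype C] (hC : Fintype.card C = 4) :
    IsGreatest {n | ∃ R : PreferenceProfile C, R.IsEuclidean (ℝ × ℝ) ∧ R.card = n} 19 := by
  refine ⟨exists_isEuclidean_card_eq hC, ?_⟩
  rintro _ ⟨R, hR, rfl⟩
  exact hR.card_le hC

/-- On four candidates, the largest number of pairwise distinct preferences in a profile that is
Euclidean in the plane is exactly 19, both for the norm `ℓ₁` and for the norm `ℓ_∞`. -/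
theorem mainTheorem1 {C : Type*} [Fintype C] (hC : Fintype.card C = 4) :
    IsGreatest (euclideanProfileSizes 1 C) 19 ∧ IsGreatest (euclideanProfileSizes ∞ C) 19 := by
  simp only [euclideanProfileSizes, PreferenceProfile.isEuclidean_piLp_one_iff,
    PreferenceProfile.isEuclidean_piLp_top_iff]
  exact ⟨isGreatest_card_isEuclidean hC, isGreatest_card_isEuclidean hC⟩
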